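/- Let $f:[0,1]\to\mathbb R$ be of class $C^2$ on $[0,1]$ with $f(0)=f(1)=0$ and $f''(0)=f''(1)=0$. By a bounded solution we mean a bounded function $u:[0,1]\times[0,\infty)\to\mathbb R$ such that $u$, $\frac{\partial u}{\partial t}$, $\frac{\partial^2 u}{\partial x^2}$ exist and are continuous on $[0,1]\times[0,\infty)$ (one-sided derivatives at the boundary) and $$\frac{\partial u}{\partial t}(x,t)-\frac{\partial^2 u}{\partial x^2}(x,t)=0\quad(0<x<1,\ t>0),\qquad u(0,t)=u(1,t)=0\quad(t>0),\qquad u(x,0)=f(x)\quad(0\le x\le 1).$$ Then there is exactly one bounded solution $u_1$, and for all $x\in[0,1]$ and all $t>0$, $$u_1(x,t)=\frac1{2\pi}\,\mathrm{P.V.}\int_{-\infty}^{\infty}\int_0^1 e^{ist}\,g(\sqrt{is},x,y)\,f(y)\,dy\,ds:=\lim_{M\to\infty}\frac1{2\pi}\int_{-M}^{M}\int_0^1 e^{ist}\,g(\sqrt{is},x,y)\,f(y)\,dy\,ds,$$ where the integrals and the limit exist, $\sqrt{is}$ denotes a square root of $is$ in $\mathbb C$ (for each $s$ either of the two may be chosen),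 and, for $x,y\in[0,1]$, $$g(m,x,y)=\frac{-1}{m\sinh m}\begin{cases}\sinh(m(x-1))\,\sinh(my), & y\le x,\\ \sinh(mx)\,\sinh(m(y-1)), & x<y,\end{cases}\quad(m\in\mathbb C,\ m\,\sinh m\ne 0),\qquad g(0,x,y)=\begin{cases}(1-x)\,y, & y\le x,\\ x\,(1-y), & x<y,\end{cases}$$ is the Green's function of $-v''+m^2v$ on $[0,1]$ with $v(0)=v(1)=0$. -/

import Mathlib

open Set Filter Topology MeasureTheory

namespace HeatDirichlet

noncomputable section

/-- The partial derivative `∂u/∂t` of `u : [0,1] × [0,∞) → ℝ` (one-sided at `t = 0`). -/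
def dt (u : ℝ → ℝ → ℝ) (x t : ℝ) : ℝ :=
  derivWithin (fun τ => u x τ) (Ici 0) t

/-- The partial derivative `∂²u/∂x²` of `u : [0,1] × [0,∞) → ℝ` (one-sided at `x = 0, 1`). -/
def dxx (u : ℝ → ℝ → ℝ) (x t : ℝ) : ℝ :=
  iteratedDerivWithin 2 (fun ξ => u ξ t) (Icc 0 1) x

/-- `u` (restricted to `[0,1] × [0,∞)`) is a bounded solution of
`u_t - u_xx = F` on `(0,1) × (0,∞)`, `u(0,t) = u(1,t) = 0` for `t > 0`, `u(x,0) = f(x)` on `[0,1]`,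
where `u`, `u_t`, `u_xx` exist and are continuous on `[0,1] × [0,∞)`.
Only the values of `u` on `[0,1] × [0,∞)` matter. -/
structure IsBoundedSolution (F : ℝ → ℝ → ℝ) (f : ℝ → ℝ) (u : ℝ → ℝ → ℝ) : Prop where
  continuousOn : ContinuousOn (fun p : ℝ × ℝ => u p.1 p.2) (Icc 0 1 ×ˢ Ici 0)
  differentiableOn_t : ∀ x ∈ Icc (0 : ℝ) 1, DifferentiableOn ℝ (fun t => u x t) (Ici 0)
  continuousOn_dt : ContinuousOn (fun p : ℝ × ℝ => dt u p.1 p.2) (Icc 0 1 ×ˢ Ici 0)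
  contDiffOn_x : ∀ t ∈ Ici (0 : ℝ), ContDiffOn ℝ 2 (fun x => u x t) (Icc 0 1)
  continuousOn_dxx : ContinuousOn (fun p : ℝ × ℝ => dxx u p.1 p.2) (Icc 0 1 ×ˢ Ici 0)
  bounded : ∃ C : ℝ, ∀ x ∈ Icc (0 : ℝ) 1, ∀ t ∈ Ici (0 : ℝ), |u x t| ≤ C
  heat : ∀ x ∈ Ioo (0 : ℝ) 1, ∀ t ∈ Ioi (0 : ℝ), dt u x t - dxx u x t = F x t
  dirichlet : ∀ t ∈ Ioi (0 : ℝ), u 0 t = 0 ∧ u 1 t = 0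
  initial : ∀ x ∈ Icc (0 : ℝ) 1, u x 0 = f x

/-- The Green's function of `-v'' + m² v` on `[0,1]` with `v(0) = v(1) = 0`
(used for `x, y ∈ [0,1]` and for `m = 0` or `sinh m ≠ 0`). -/
def green (m : ℂ) (x y : ℝ) : ℂ :=
  if m = 0 then
    if y ≤ x then (1 - x) * y else x * (1 - y)
  else
    -1 / (m * Complex.sinh m) *
      if y ≤ x then Complex.sinh (m * (x - 1)) * Complex.sinh (m * y)
      else Complex.sinh (m * x) * Complex.sinh (m * (y - 1))

/-- The principal value `P.V. ∫_{-∞}^{∞} φ(s) ds = lim_{M → ∞} ∫_{-M}^{M} φ(s) ds`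
exists and equals `L`. -/
def HasPVIntegral (φ : ℝ → ℂ) (L : ℂ) : Prop :=
  (∀ M : ℝ, IntervalIntegrable φ volume (-M) M) ∧
    Tendsto (fun M : ℝ => ∫ s in (-M)..M, φ s) atTop (𝓝 L)

end

end HeatDirichlet

namespace HeatDirichlet

/-! Uniqueness is the parabolic maximum principle. For existence, the conditions on `f` and `f''` at
`0` and `1` are exactly what lets `f` extend to an odd, 2-periodic `C²` function `F` on the line
(`exists_odd_periodic_C2_extension`). Its Gaussian average `E[F(x + √(2t) Z)]` solves the heat
equation with continuous derivatives down to `t = 0`, and the symmetries of `F` about `0` and `1`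
give the Dirichlet conditions (`isBoundedSolution_heat`).

For the formula, write `F = ∑ bₙ sin(πnx)` with `∑ ‖bₙ‖ < ∞`. Gaussian averaging multiplies the
`n`-th mode by `e^{-(πn)²t}` (`hasSum_heat`), while integration against the Green's function at `m²
= is` divides it by `(πn)² + is` (`hasSum_integral_green`). Everything reduces to the scalar
identity `P.V. ∫ e^{ist}/(a + is) ds = 2π e^{-at}` for `a ≥ 1`, `t > 0`
(`tendsto_integral_exp_div`). The truncated integrals are bounded uniformly in `a` and `M`
(`norm_integral_exp_div_le`), so limit and sum may be exchanged (`hasPVIntegral_of_hasSum`). -/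

/-! ### Odd 2-periodic extension of the initial value -/

/-- With `e` the extension of `h` by zero, `e x - e (-x)` is continuous and odd. It vanishes at
`±1`, so it descends from `[-1, 1]` to the circle of length 2. -/
theorem exists_odd_periodic_continuous_extension {h : ℝ → ℝ} (hc : ContinuousOn h (Icc 0 1))
    (h0 : h 0 = 0) (h1 : h 1 = 0) :
    ∃ H : ℝ → ℝ, Continuous H ∧ (∀ x, H (-x) = -H x) ∧ Function.Periodic H 2 ∧
      EqOn H h (Icc 0 1) := by
  let e : ℝ → ℝ := IccExtend (zero_le_one (α := ℝ)) (fun y => h y)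
  have he : Continuous e := (continuousOn_iff_continuous_domRestrict.1 hc).Icc_extend'
  have e_of_nonpos : ∀ x ≤ 0, e x = 0 := fun x hx => by
    simp [e, IccExtend_of_le_left zero_le_one _ hx, h0]
  have e_of_ge : ∀ x, 1 ≤ x → e x = 0 := fun x hx => by
    simp [e, IccExtend_of_right_le zero_le_one _ hx, h1]
  have e_of_mem : ∀ x ∈ Icc (0 : ℝ) 1, e x = h x := fun x hx => by
    simp [e, IccExtend_of_mem zero_le_one _ hx]
  let k : ℝ → ℝ := fun x => e x - e (-x)
  have hk : Continuous k := he.sub (he.comp continuous_neg)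
  have : Fact ((0 : ℝ) < 2) := ⟨two_pos⟩
  let K : AddCircle (2 : ℝ) → ℝ := AddCircle.liftIco 2 (-1) k
  have hKc : Continuous K := by
    refine AddCircle.liftIco_continuous ?_ hk.continuousOn
    have := e_of_ge 1 le_rfl
    have := e_of_nonpos (-1) (by norm_num)
    norm_num [k]
    simp_all
  have hK : ∀ y ∈ Icc (-1 : ℝ) 1, K (y : AddCircle (2 : ℝ)) = k y := by
    intro y hy
    rcases hy.2.eq_or_lt with rfl | hlt
    · have h2 : ((1 : ℝ) : AddCircle (2 : ℝ)) = ((-1 : ℝ) : AddCircle (2 : ℝ)) := by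
        rw [← AddCircle.coe_add_period 2 (-1)]; norm_num
      have h3 : K ((-1 : ℝ) : AddCircle (2 : ℝ)) = k (-1) :=
        AddCircle.liftIco_coe_apply (f := k) (by constructor <;> norm_num)
      rw [h2, h3]
      have := e_of_ge 1 le_rfl
      have := e_of_nonpos (-1) (by norm_num)
      simp only [k, neg_neg]; linarith
    · exact AddCircle.liftIco_coe_apply ⟨hy.1, by linarith⟩
  refine ⟨fun x => K x, hKc.comp (AddCircle.continuous_mk' 2), fun x => ?_, fun x => ?_,
    fun x hx => ?_⟩
  · obtain ⟨y, hy, hxy⟩ : ∃ y ∈ Ico (-1 : ℝ) 1, ((y : ℝ) : AddCircle (2 : ℝ)) = x := by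
      refine ⟨(AddCircle.equivIco 2 (-1 : ℝ) (x : AddCircle (2 : ℝ)) : ℝ), ?_, ?_⟩
      · have := (AddCircle.equivIco 2 (-1 : ℝ) (x : AddCircle (2 : ℝ))).2
        exact ⟨this.1, by linarith [this.2]⟩
      · exact (AddCircle.equivIco 2 (-1 : ℝ)).symm_apply_apply _
    have hneg : (((-x : ℝ)) : AddCircle (2 : ℝ)) = ((-y : ℝ) : AddCircle (2 : ℝ)) := by
      rw [AddCircle.coe_neg, AddCircle.coe_neg, hxy]
    change K _ = - K _
    rw [hneg, ← hxy, hK y ⟨hy.1, hy.2.le⟩, hK (-y) ⟨by linarith [hy.2], by linarith [hy.1]⟩]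
    simp [k]
  · change K _ = K _
    rw [AddCircle.coe_add_period]
  · change K _ = _
    rw [hK x ⟨by linarith [hx.1], hx.2⟩]
    simp only [k]
    rw [e_of_mem x hx, e_of_nonpos (-x) (by linarith [hx.1]), sub_zero]

theorem eq_zero_of_hasDerivAt_zero {G : ℝ → ℝ} (hG : ∀ x, HasDerivAt G 0 x) (h0 : G 0 = 0)
    (x : ℝ) : G x = 0 :=
  h0 ▸ is_const_of_deriv_eq_zero (fun x => (hG x).differentiableAt) (fun x => (hG x).deriv) x 0

/-- Extend `f''` to `H` and integrate twice, with the constants `f'(0)` and `f(0) = 0`. Being odd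
about both `0` and `1` is the same as being odd and 2-periodic, and it passes from `H` to `F`
because `F 0 = F 1 = 0`. -/
theorem exists_odd_periodic_C2_extension {f : ℝ → ℝ} (hf : ContDiffOn ℝ 2 f (Icc 0 1))
    (hf0 : f 0 = 0) (hf1 : f 1 = 0)
    (hf0'' : iteratedDerivWithin 2 f (Icc 0 1) 0 = 0)
    (hf1'' : iteratedDerivWithin 2 f (Icc 0 1) 1 = 0) :
    ∃ F F₁ F₂ : ℝ → ℝ, (∀ x, HasDerivAt F (F₁ x) x) ∧ (∀ x, HasDerivAt F₁ (F₂ x) x) ∧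
      Continuous F₂ ∧ (∀ x, F (-x) = -F x) ∧ Function.Periodic F 2 ∧
      Function.Periodic F₁ 2 ∧ Function.Periodic F₂ 2 ∧ EqOn F f (Icc 0 1) := by
  have hu : UniqueDiffOn ℝ (Icc (0 : ℝ) 1) := uniqueDiffOn_Icc zero_lt_one
  obtain ⟨H, hHc, hHodd, hHper, hHeq⟩ := exists_odd_periodic_continuous_extension
    (hf.continuousOn_iteratedDerivWithin (m := 2) (by norm_num) hu) hf0'' hf1''
  set s := Icc (0 : ℝ) 1
  let F₁ : ℝ → ℝ := fun x => derivWithin f s 0 + ∫ y in (0 : ℝ)..x, H y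
  have hF₁ : ∀ x, HasDerivAt F₁ (H x) x := fun x =>
    (hHc.integral_hasStrictDerivAt 0 x).hasDerivAt.const_add _
  have hF₁c : Continuous F₁ := continuous_iff_continuousAt.2 fun x => (hF₁ x).continuousAt
  let F : ℝ → ℝ := fun x => ∫ y in (0 : ℝ)..x, F₁ y
  have hF : ∀ x, HasDerivAt F (F₁ x) x := fun x => (hF₁c.integral_hasStrictDerivAt 0 x).hasDerivAt
  have hfd : DifferentiableOn ℝ f s := hf.differentiableOn (by norm_num)
  have hfd' : DifferentiableOn ℝ (derivWithin f s) s :=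
    ((contDiffOn_succ_iff_derivWithin (n := 1) hu).1 (by exact_mod_cast hf)).2.2.differentiableOn
      (by norm_num)
  have e1 : ∀ y ∈ s, F₁ y = derivWithin f s y := by
    refine eq_of_derivWithin_eq (fun x _ => (hF₁ x).differentiableAt.differentiableWithinAt) hfd'
      (fun x hx => ?_) (by simp [F₁])
    have hx' : x ∈ s := ⟨hx.1, hx.2.le⟩
    rw [(hF₁ x).hasDerivWithinAt.derivWithin (hu x hx'), hHeq hx', iteratedDerivWithin_succ]
    rw [iteratedDerivWithin_one]
  have e0 : ∀ y ∈ s, F y = f y := by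
    refine eq_of_derivWithin_eq (fun x _ => (hF x).differentiableAt.differentiableWithinAt) hfd
      (fun x hx => ?_) (by simp [F, hf0])
    have hx' : x ∈ s := ⟨hx.1, hx.2.le⟩
    rw [(hF x).hasDerivWithinAt.derivWithin (hu x hx'), e1 x hx']
  have hF1 : F 1 = 0 := by rw [e0 1 (by simp [s]), hf1]
  have sub_refl : ∀ (G G' : ℝ → ℝ), (∀ x, HasDerivAt G (G' x) x) → ∀ c x,
      HasDerivAt (fun x => G (c - x)) (-G' (c - x)) x := fun G G' h c x => by
    simpa using (h (c - x)).comp_const_sub c x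
  have add_refl : ∀ (G G' : ℝ → ℝ), (∀ x, HasDerivAt G (G' x) x) → ∀ c x,
      HasDerivAt (fun x => G (c + x)) (G' (c + x)) x := fun G G' h c x => by
    simpa using (h (c + x)).comp_const_add c x
  -- As a function of `x`, `F (c + x) + F (c - x)` has zero second derivative, and its value and
  -- first derivative vanish at `x = 0`.
  have key : ∀ c, F c = 0 → (∀ x, H (c + x) + H (c - x) = 0) → ∀ x, F (c + x) + F (c - x) = 0 := by
    intro c hc hH
    have d1 : ∀ x, F₁ (c + x) - F₁ (c - x) = 0 := by
      refine eq_zero_of_hasDerivAt_zero (fun x => ?_) (by simp)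
      refine ((add_refl _ _ hF₁ c x).sub (sub_refl _ _ hF₁ c x)).congr_deriv ?_
      linarith [hH x]
    refine eq_zero_of_hasDerivAt_zero (fun x => ?_) (by simp [hc])
    refine ((add_refl _ _ hF c x).add (sub_refl _ _ hF c x)).congr_deriv ?_
    linarith [d1 x]
  have k0 := key 0 (by simp [F]) (fun x => by simp [hHodd])
  have k1 := key 1 hF1 (fun x => by
    have := hHodd (1 + x)
    rw [← hHper] at this
    rw [show (1 : ℝ) - x = -(1 + x) + 2 by ring]; linarith)
  have hodd : ∀ x, F (-x) = -F x := fun x => by have := k0 x; simp at this; linarith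
  have hper : Function.Periodic F 2 := fun x => by
    have := k1 (1 + x)
    rw [show (1 : ℝ) - (1 + x) = -x by ring, hodd, show (1 : ℝ) + (1 + x) = x + 2 by ring] at this
    linarith
  refine ⟨F, F₁, H, hF, hF₁, hHc, hodd, hper, fun x => ?_, hHper, e0⟩
  have h1 : HasDerivAt (fun x => F (x + 2)) (F₁ (x + 2)) x := (hF (x + 2)).comp_add_const x 2
  rw [funext hper] at h1
  exact h1.unique (hF x)

theorem _root_.Function.Periodic.exists_abs_le {G : ℝ → ℝ} {c : ℝ} (hp : Function.Periodic G c)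
    (hc : c ≠ 0) (hG : Continuous G) : ∃ C, ∀ x, |G x| ≤ C := by
  obtain ⟨C, hC⟩ := (hp.isBounded_of_continuous hc hG).exists_norm_le
  exact ⟨C, fun x => hC _ (mem_range_self x)⟩

/-! ### Uniqueness by the maximum principle -/

/-- A positive second derivative would make `x` a local minimum too, hence `φ` locally constant,
with second derivative zero. -/
theorem deriv_deriv_nonpos_of_isLocalMax {φ : ℝ → ℝ} {x : ℝ} (h : IsLocalMax φ x)
    (hc : ContinuousAt φ x) : deriv (deriv φ) x ≤ 0 := by
  by_contra! hpos
  have hmin := isLocalMin_of_deriv_deriv_pos hpos h.deriv_eq_zero hc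
  have hconst : φ =ᶠ[𝓝 x] fun _ => φ x := by
    filter_upwards [h, hmin] with y h1 h2 using le_antisymm h1 h2
  have := hconst.deriv.deriv_eq
  simp at this
  linarith

theorem dxx_eq_deriv_deriv {u : ℝ → ℝ → ℝ} {x t : ℝ} (hx : x ∈ Ioo (0 : ℝ) 1) :
    dxx u x t = deriv (deriv fun ξ => u ξ t) x := by
  have hev : Icc (0 : ℝ) 1 =ᶠ[𝓝 x] univ := eventuallyEq_univ.2 (Icc_mem_nhds hx.1 hx.2)
  rw [dxx, iteratedDerivWithin, iteratedFDerivWithin_congr_set hev, ← iteratedDerivWithin,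
    iteratedDerivWithin_univ, iteratedDeriv_succ, iteratedDeriv_one]

/-- Subtracting `ε t` makes the differential inequality strict: at a maximum of `v - u - ε t` off
the parabolic boundary, the time derivative of `v - u` is at least `ε` and its second space
derivative at most `0`, contradicting the equation. Then `ε → 0`. -/
theorem IsBoundedSolution.sub_le_zero {F : ℝ → ℝ → ℝ} {f : ℝ → ℝ} {v u : ℝ → ℝ → ℝ}
    (hv : IsBoundedSolution F f v) (hu : IsBoundedSolution F f u)
    {x t : ℝ} (hx : x ∈ Icc (0 : ℝ) 1) (ht : t ∈ Ici (0 : ℝ)) : v x t - u x t ≤ 0 := by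
  have main : ∀ ε > 0, v x t - u x t - ε * t ≤ 0 := by
    intro ε hε
    let ψ : ℝ × ℝ → ℝ := fun p => v p.1 p.2 - u p.1 p.2 - ε * p.2
    have hsub : Icc (0 : ℝ) 1 ×ˢ Icc (0 : ℝ) t ⊆ Icc (0 : ℝ) 1 ×ˢ Ici (0 : ℝ) :=
      prod_mono_right Icc_subset_Ici_self
    have hψ : ContinuousOn ψ (Icc (0 : ℝ) 1 ×ˢ Icc (0 : ℝ) t) :=
      (((hv.continuousOn.sub hu.continuousOn).mono hsub)).sub (by fun_prop)
    obtain ⟨⟨x₀, t₀⟩, ⟨hx₀, ht₀⟩, hmax⟩ := (isCompact_Icc.prod isCompact_Icc).exists_isMaxOn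
      ⟨(x, t), hx, ht, le_rfl⟩ hψ
    have hmax' : ∀ y ∈ Icc (0 : ℝ) 1, ∀ τ ∈ Icc (0 : ℝ) t, ψ (y, τ) ≤ ψ (x₀, t₀) :=
      fun y hy τ hτ => hmax (mk_mem_prod hy hτ)
    simp only at hx₀ ht₀
    refine (hmax' x hx t ⟨ht, le_rfl⟩).trans ?_
    rcases ht₀.1.eq_or_lt with h0 | h0
    · simp only [ψ, ← h0]
      rw [hv.initial x₀ hx₀, hu.initial x₀ hx₀]; simp
    rcases hx₀.1.eq_or_lt with h1 | h1
    · simp only [ψ, ← h1, (hv.dirichlet t₀ h0).1, (hu.dirichlet t₀ h0).1]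
      nlinarith
    rcases hx₀.2.eq_or_lt with h2 | h2
    · simp only [ψ, h2, (hv.dirichlet t₀ h0).2, (hu.dirichlet t₀ h0).2]
      nlinarith
    exfalso
    have hxx : dxx v x₀ t₀ - dxx u x₀ t₀ ≤ 0 := by
      have hcd : ∀ {w}, IsBoundedSolution F f w → ContDiffAt ℝ 2 (fun ξ => w ξ t₀) x₀ :=
        fun hw => (hw.contDiffOn_x t₀ h0.le).contDiffAt (Icc_mem_nhds h1 h2)
      have hs : dxx v x₀ t₀ - dxx u x₀ t₀ = deriv (deriv fun ξ => v ξ t₀ - u ξ t₀) x₀ := by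
        rw [dxx_eq_deriv_deriv ⟨h1, h2⟩, dxx_eq_deriv_deriv ⟨h1, h2⟩]
        have := iteratedDeriv_sub (hcd hv) (hcd hu)
        simp only [iteratedDeriv_succ, iteratedDeriv_zero] at this
        rw [← this]; rfl
      rw [hs]
      refine deriv_deriv_nonpos_of_isLocalMax ?_
        ((hcd hv).continuousAt.sub (hcd hu).continuousAt)
      filter_upwards [Icc_mem_nhds h1 h2] with y hy
      have := hmax' y hy t₀ ht₀
      simp only [ψ] at this
      linarith
    have htt : ε ≤ dt v x₀ t₀ - dt u x₀ t₀ := by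
      -- Only difference quotients from the left are compared, since the maximum may lie at the
      -- final time.
      have hd : ∀ {w}, IsBoundedSolution F f w →
          HasDerivWithinAt (fun τ => w x₀ τ) (dt w x₀ t₀) (Iic t₀) t₀ := fun hw =>
        (((hw.differentiableOn_t x₀ hx₀) t₀ h0.le).hasDerivWithinAt.hasDerivAt
          (Ici_mem_nhds h0)).hasDerivWithinAt
      have hd' := ((hd hv).sub (hd hu)).sub ((hasDerivWithinAt_id t₀ (Iic t₀)).const_mul ε)
      have hnn := hasDerivWithinAt_iff_tendsto_slope.1 hd'
      have : 0 ≤ dt v x₀ t₀ - dt u x₀ t₀ - ε * 1 := by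
        rw [show Iic t₀ \ {t₀} = Iio t₀ from Iic_sdiff_right] at hnn
        refine ge_of_tendsto hnn ?_
        filter_upwards [Ioo_mem_nhdsLT h0] with τ hτ
        rw [slope_def_field]
        refine div_nonneg_of_nonpos ?_ (by linarith [hτ.2])
        have := hmax' x₀ hx₀ τ ⟨hτ.1.le, hτ.2.le.trans ht₀.2⟩
        simp only [ψ] at this
        simp only [Pi.sub_apply, id]
        linarith
      linarith
    have := hv.heat x₀ ⟨h1, h2⟩ t₀ h0
    have := hu.heat x₀ ⟨h1, h2⟩ t₀ h0
    linarith
  have hlim : Tendsto (fun ε : ℝ => v x t - u x t - ε * t) (𝓝[>] 0) (𝓝 (v x t - u x t - 0 * t)) :=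
    Tendsto.mono_left (Continuous.tendsto (by fun_prop) 0) nhdsWithin_le_nhds
  have := le_of_tendsto hlim (eventually_mem_nhdsWithin.mono fun ε hε => main ε hε)
  simpa using this

theorem IsBoundedSolution.unique {F : ℝ → ℝ → ℝ} {f : ℝ → ℝ} {v u : ℝ → ℝ → ℝ}
    (hv : IsBoundedSolution F f v) (hu : IsBoundedSolution F f u)
    {x t : ℝ} (hx : x ∈ Icc (0 : ℝ) 1) (ht : t ∈ Ici (0 : ℝ)) : v x t = u x t :=
  le_antisymm (sub_nonpos.1 (hv.sub_le_zero hu hx ht)) (sub_nonpos.1 (hu.sub_le_zero hv hx ht))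

/-! ### Existence by Gaussian averaging -/

section

open ProbabilityTheory

/-- The solution `E[K(x + √(2t) Z)]`, `Z` standard Gaussian, of the heat equation on the line with
initial value `K`. -/
noncomputable def heat (K : ℝ → ℝ) (x t : ℝ) : ℝ :=
  ∫ z, K (x + √(2 * t) * z) ∂gaussianReal 0 1

theorem integrable_comp_of_abs_le {μ : Measure ℝ} [IsFiniteMeasure μ] {G : ℝ → ℝ}
    (hG : Continuous G) {C : ℝ} (hC : ∀ x, |G x| ≤ C) : Integrable G μ :=
  Integrable.of_bound hG.aestronglyMeasurable C (ae_of_all _ hC)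

theorem heat_zero (K : ℝ → ℝ) (x : ℝ) : heat K x 0 = K x := by simp [heat]

theorem abs_heat_le {K : ℝ → ℝ} {C : ℝ} (hC : ∀ x, |K x| ≤ C) (x t : ℝ) : |heat K x t| ≤ C := by
  have := norm_integral_le_of_norm_le_const (μ := gaussianReal 0 1)
    (f := fun z => K (x + √(2 * t) * z)) (ae_of_all _ fun z => hC _)
  simpa [heat] using this

theorem continuous_heat {K : ℝ → ℝ} (hK : Continuous K) {C : ℝ} (hC : ∀ x, |K x| ≤ C) :
    Continuous fun p : ℝ × ℝ => heat K p.1 p.2 := by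
  refine continuous_of_dominated (bound := fun _ => C)
    (fun p => (by fun_prop : Continuous fun z => K (p.1 + √(2 * p.2) * z)).aestronglyMeasurable)
    (fun p => ae_of_all _ fun z => hC _) (integrable_const C) (ae_of_all _ fun z => by fun_prop)

theorem hasDerivAt_heat_space {K K' : ℝ → ℝ} (hK : ∀ x, HasDerivAt K (K' x) x)
    (hK' : Continuous K') {C C' : ℝ} (hC : ∀ x, |K x| ≤ C) (hC' : ∀ x, |K' x| ≤ C') (x t : ℝ) :
    HasDerivAt (fun x => heat K x t) (heat K' x t) x := by
  have hKc : Continuous K := continuous_iff_continuousAt.2 fun x => (hK x).continuousAt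
  refine (hasDerivAt_integral_of_dominated_loc_of_deriv_le (s := univ) (bound := fun _ => C')
    (F := fun x z => K (x + √(2 * t) * z)) (F' := fun x z => K' (x + √(2 * t) * z))
    univ_mem (Eventually.of_forall fun y => ?_) ?_ ?_ (ae_of_all _ fun z y _ => hC' _)
    (integrable_const C') (ae_of_all _ fun z y _ => ?_)).2
  · exact (by fun_prop : Continuous fun z => K (y + √(2 * t) * z)).aestronglyMeasurable
  · exact integrable_comp_of_abs_le (by fun_prop) (fun z => hC _)
  · exact (by fun_prop : Continuous fun z => K' (x + √(2 * t) * z)).aestronglyMeasurable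
  · exact (hK _).comp_add_const y _

/-- Gaussian integration by parts (Stein's identity): the density satisfies `p' = -z p`. -/
theorem integral_mul_gaussianReal {G G' : ℝ → ℝ} (hG : ∀ x, HasDerivAt G (G' x) x)
    (hG' : Continuous G') {C C' : ℝ} (hC : ∀ x, |G x| ≤ C) (hC' : ∀ x, |G' x| ≤ C') :
    ∫ z, G z * z ∂gaussianReal 0 1 = ∫ z, G' z ∂gaussianReal 0 1 := by
  have hGc : Continuous G := continuous_iff_continuousAt.2 fun x => (hG x).continuousAt
  set p : ℝ → ℝ := gaussianPDFReal 0 1 with hp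
  have hpd : ∀ z, HasDerivAt p (-z * p z) z := fun z => by
    have h1 : HasDerivAt (fun z : ℝ => -z ^ 2 / 2) (-z) z := by
      refine ((hasDerivAt_pow 2 z).neg.div_const 2).congr_deriv ?_
      simp only [Nat.cast_ofNat]; ring
    have h2 := (h1.exp).const_mul ((√(2 * Real.pi))⁻¹)
    refine (h2.congr_of_eventuallyEq (Eventually.of_forall fun y => ?_)).congr_deriv ?_
    · simp [hp, gaussianPDFReal]
    · simp [hp, gaussianPDFReal]; ring
  have hpi : Integrable p := integrable_gaussianPDFReal 0 1
  have hzp : Integrable fun z => z * p z := by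
    have h := (memLp_id_gaussianReal (μ := 0) (v := 1) 1).integrable le_rfl
    rw [gaussianReal_of_var_ne_zero 0 one_ne_zero,
      integrable_withDensity_iff_integrable_smul' (measurable_gaussianPDF 0 1)
        (ae_of_all _ fun _ => gaussianPDF_lt_top)] at h
    refine h.congr (ae_of_all _ fun z => ?_)
    simp [toReal_gaussianPDF, hp, mul_comm]
  have bdd : ∀ {g k : ℝ → ℝ} {B}, Integrable k → Continuous g → (∀ x, |g x| ≤ B) →
      Integrable fun z => g z * k z := fun hk hg hB =>
    hk.bdd_mul hg.aestronglyMeasurable (ae_of_all _ hB)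
  rw [integral_gaussianReal_eq_integral_smul one_ne_zero,
    integral_gaussianReal_eq_integral_smul one_ne_zero]
  have key := integral_mul_deriv_eq_deriv_mul_of_integrable (u := G) (u' := G') (v := p)
    (v' := fun z => -z * p z) (fun z _ => hG z) (fun z _ => hpd z)
    ((bdd hzp hGc hC).neg.congr (ae_of_all _ fun z => by simp)) (bdd hpi hG' hC') (bdd hpi hGc hC)
  calc ∫ z, p z • (G z * z) = - ∫ z, G z * (-z * p z) := by
        rw [← integral_neg]; congr 1; ext z; simp; ring
    _ = ∫ z, G' z * p z := by rw [key, neg_neg]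
    _ = ∫ z, p z • G' z := by congr 1; ext z; simp [mul_comm]

/-- Differentiating under the integral gives `E[K₁(x + cZ) Z / c]` with `c = √(2t)`; Stein's
identity trades `Z` for `c` and one more derivative. -/
theorem hasDerivAt_heat_time {K K₁ K₂ : ℝ → ℝ} (hK : ∀ x, HasDerivAt K (K₁ x) x)
    (hK₁ : ∀ x, HasDerivAt K₁ (K₂ x) x) (hK₂ : Continuous K₂) {C C₁ C₂ : ℝ}
    (hC : ∀ x, |K x| ≤ C) (hC₁ : ∀ x, |K₁ x| ≤ C₁) (hC₂ : ∀ x, |K₂ x| ≤ C₂) (x : ℝ) {t : ℝ}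
    (ht : 0 < t) : HasDerivAt (fun t => heat K x t) (heat K₂ x t) t := by
  have hKc : Continuous K := continuous_iff_continuousAt.2 fun x => (hK x).continuousAt
  have hK₁c : Continuous K₁ := continuous_iff_continuousAt.2 fun x => (hK₁ x).continuousAt
  have hint : Integrable (fun z : ℝ => z) (gaussianReal 0 1) :=
    (memLp_id_gaussianReal (μ := 0) (v := 1) 1).integrable le_rfl
  -- For `τ > t / 2` one has `√(2τ) ≥ √t`, whence a bound independent of `τ`.
  have hd := (hasDerivAt_integral_of_dominated_loc_of_deriv_le (s := Ioi (t / 2))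
    (μ := gaussianReal 0 1) (x₀ := t) (bound := fun z => C₁ * (|z| / √t))
    (F := fun τ z => K (x + √(2 * τ) * z))
    (F' := fun τ z => K₁ (x + √(2 * τ) * z) * (z / √(2 * τ)))
    (Ioi_mem_nhds (by linarith)) (Eventually.of_forall fun τ => ?_) ?_ ?_
    (ae_of_all _ fun z τ hτ => ?_) ((hint.abs.div_const _).const_mul _)
    (ae_of_all _ fun z τ hτ => ?_)).2
  · refine hd.congr_deriv ?_
    set c := √(2 * t) with hc
    have hc0 : 0 < c := Real.sqrt_pos.2 (by linarith)
    have hlin : ∀ z, HasDerivAt (fun z => x + c * z) c z := fun z => by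
      simpa using ((hasDerivAt_id z).const_mul c).const_add x
    have := integral_mul_gaussianReal (G := fun z => K₁ (x + c * z))
      (G' := fun z => K₂ (x + c * z) * c) (C := C₁) (C' := C₂ * c)
      (fun z => (hK₁ _).comp z (hlin z)) (by fun_prop) (fun z => hC₁ _)
      (fun z => by rw [abs_mul, abs_of_pos hc0]; gcongr; exact hC₂ _)
    rw [integral_mul_const] at this
    simp_rw [← mul_div_assoc]
    rw [integral_div, this, heat, mul_div_assoc, div_self hc0.ne', mul_one]
  · exact (by fun_prop : Continuous fun z => K (x + √(2 * τ) * z)).aestronglyMeasurable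
  · exact integrable_comp_of_abs_le (by fun_prop) (fun z => hC _)
  · exact (by fun_prop :
      Continuous fun z => K₁ (x + √(2 * t) * z) * (z / √(2 * t))).aestronglyMeasurable
  · have hle : √t ≤ √(2 * τ) := Real.sqrt_le_sqrt (by linarith [mem_Ioi.1 hτ])
    have h0 : 0 < √t := Real.sqrt_pos.2 ht
    rw [norm_mul, norm_div, Real.norm_eq_abs, Real.norm_eq_abs, Real.norm_of_nonneg (by positivity)]
    have := (abs_nonneg _).trans (hC₁ 0)
    gcongr
    exact hC₁ _
  · have hτ0 : 0 < τ := by linarith [mem_Ioi.1 hτ]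
    have h1 : HasDerivAt (fun τ : ℝ => √(2 * τ)) (1 / √(2 * τ)) τ := by
      refine (((hasDerivAt_id τ).const_mul 2).sqrt (by simp [hτ0.ne'])).congr_deriv ?_
      simp
      field_simp
    have h2 := (h1.mul_const z).const_add x
    refine ((hK _).comp τ h2).congr_deriv ?_
    ring

theorem isBoundedSolution_heat {f F F₁ F₂ : ℝ → ℝ} (hF : ∀ x, HasDerivAt F (F₁ x) x)
    (hF₁ : ∀ x, HasDerivAt F₁ (F₂ x) x) (hF₂ : Continuous F₂) (hodd : ∀ x, F (-x) = -F x)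
    (hper : Function.Periodic F 2) {C C₁ C₂ : ℝ}
    (hC : ∀ x, |F x| ≤ C) (hC₁ : ∀ x, |F₁ x| ≤ C₁) (hC₂ : ∀ x, |F₂ x| ≤ C₂)
    (hf : EqOn F f (Icc 0 1)) : IsBoundedSolution (fun _ _ => 0) f (heat F) := by
  have hFc : Continuous F := continuous_iff_continuousAt.2 fun x => (hF x).continuousAt
  have hF₁c : Continuous F₁ := continuous_iff_continuousAt.2 fun x => (hF₁ x).continuousAt
  have c0 := continuous_heat hFc hC
  have c2 := continuous_heat hF₂ hC₂
  have ht : ∀ x t, 0 ≤ t → HasDerivWithinAt (fun t => heat F x t) (heat F₂ x t) (Ici 0) t := by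
    intro x t h0
    rcases h0.eq_or_lt with rfl | hpos
    -- `√(2t)` is not differentiable at `0`; the one-sided derivative there is the limit of the
    -- derivatives at positive times.
    · refine hasDerivWithinAt_Ici_of_tendsto_deriv (s := Ioi 0)
        (fun τ hτ => (hasDerivAt_heat_time hF hF₁ hF₂ hC hC₁ hC₂ x
          hτ).differentiableAt.differentiableWithinAt)
        (c0.comp (Continuous.prodMk_right x)).continuousWithinAt self_mem_nhdsWithin ?_
      have : Tendsto (fun t => heat F₂ x t) (𝓝[>] 0) (𝓝 (heat F₂ x 0)) :=
        ((c2.comp (Continuous.prodMk_right x)).tendsto 0).mono_left nhdsWithin_le_nhds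
      refine this.congr' (eventually_mem_nhdsWithin.mono fun τ hτ => ?_)
      exact (hasDerivAt_heat_time hF hF₁ hF₂ hC hC₁ hC₂ x hτ).deriv.symm
    · exact (hasDerivAt_heat_time hF hF₁ hF₂ hC hC₁ hC₂ x hpos).hasDerivWithinAt
  have hdt : ∀ x t, 0 ≤ t → dt (heat F) x t = heat F₂ x t := fun x t h0 =>
    (ht x t h0).derivWithin (uniqueDiffOn_Ici 0 t h0)
  have hx1 := hasDerivAt_heat_space hF hF₁c hC hC₁
  have hx2 := hasDerivAt_heat_space hF₁ hF₂ hC₁ hC₂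
  have hd1 : ∀ t, deriv (fun x => heat F x t) = fun x => heat F₁ x t := fun t =>
    funext fun x => (hx1 x t).deriv
  have hd2 : ∀ t, deriv (fun x => heat F₁ x t) = fun x => heat F₂ x t := fun t =>
    funext fun x => (hx2 x t).deriv
  have hcd : ∀ t, ContDiff ℝ 2 fun x => heat F x t := fun t => by
    rw [show (2 : WithTop ℕ∞) = 1 + 1 by norm_num, contDiff_succ_iff_deriv]
    refine ⟨fun x => (hx1 x t).differentiableAt, by simp, ?_⟩
    rw [hd1, contDiff_one_iff_deriv, hd2]
    exact ⟨fun x => (hx2 x t).differentiableAt, c2.comp (Continuous.prodMk_left t)⟩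
  have hdxx : ∀ x ∈ Icc (0 : ℝ) 1, ∀ t, dxx (heat F) x t = heat F₂ x t := fun x hx t => by
    rw [dxx, iteratedDerivWithin_eq_iteratedDeriv (uniqueDiffOn_Icc zero_lt_one)
      (hcd t).contDiffAt hx, iteratedDeriv_succ, iteratedDeriv_one, hd1, hd2]
  -- `Z` and `-Z` have the same law, so a function odd about `c` averages to zero there.
  have hzero : ∀ c t, (∀ y, F (c + -y) = -F (c + y)) → heat F c t = 0 := fun c t h => by
    have hsymm : ∫ z, F (c + √(2 * t) * -z) ∂gaussianReal 0 1 = heat F c t := by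
      have := integral_map (μ := gaussianReal 0 1) (φ := fun z : ℝ => -z)
        (f := fun z => F (c + √(2 * t) * z)) (by fun_prop)
        (by fun_prop : Continuous fun z => F (c + √(2 * t) * z)).aestronglyMeasurable
      rw [gaussianReal_map_neg, neg_zero] at this
      exact this.symm
    simp_rw [mul_neg, h, integral_neg] at hsymm
    unfold heat at hsymm ⊢
    linarith
  refine ⟨c0.continuousOn, fun x _ t h0 => (ht x t h0).differentiableWithinAt,
    c2.continuousOn.congr fun p hp => hdt _ _ hp.2, fun t _ => (hcd t).contDiffOn,
    c2.continuousOn.congr fun p hp => hdxx _ hp.1 _, ⟨C, fun x _ t _ => abs_heat_le hC x t⟩,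
    fun x hx t h0 => ?_, fun t _ => ⟨hzero 0 t (by simpa using hodd), hzero 1 t fun y => ?_⟩,
    fun x hx => (heat_zero F x).trans (hf hx)⟩
  · rw [hdt x t (le_of_lt h0), hdxx x (Ioo_subset_Icc_self hx), sub_self]
  · rw [← hodd, ← hper (-(1 + y))]; congr 1; ring

end

/-! ### The principal value of `e^{ist}/(a + is)` -/

section

open Complex FourierTransform

theorem add_mul_I_ne_zero {a : ℝ} (ha : a ≠ 0) (s : ℝ) : (a + s * I : ℂ) ≠ 0 := fun h => by
  simpa [ha] using congrArg Complex.re h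

theorem norm_exp_mul_I_mul (s t : ℝ) : ‖exp (s * I * t)‖ = 1 := by
  rw [show (s * I * t : ℂ) = (s * t : ℝ) * I by push_cast; ring, norm_exp_ofReal_mul_I]

theorem le_norm_add_mul_I {a : ℝ} (ha : 0 ≤ a) (s : ℝ) : a ≤ ‖(a + s * I : ℂ)‖ := by
  simpa [abs_of_nonneg ha] using abs_re_le_norm (a + s * I : ℂ)

theorem integral_Ioi_mul_exp_neg {c : ℂ} (hc : 0 < c.re) :
    IntegrableOn (fun v : ℝ => (v : ℂ) * exp (-c * v)) (Ioi 0) ∧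
      ∫ v in Ioi (0 : ℝ), (v : ℂ) * exp (-c * v) = 1 / c ^ 2 := by
  have hc0 : c ≠ 0 := fun h => by simp [h] at hc
  have hnorm : ∀ v : ℝ, ‖exp (-c * v)‖ = Real.exp (-c.re * v) := fun v => by
    rw [Complex.norm_exp]; simp
  have hint : IntegrableOn (fun v : ℝ => (v : ℂ) * exp (-c * v)) (Ioi 0) := by
    have h := integrableOn_rpow_mul_exp_neg_mul_rpow (p := 1) (s := 1) (b := c.re)
      (by norm_num) one_pos hc
    refine Integrable.mono' h
      (by fun_prop : Continuous fun v : ℝ => (v : ℂ) * exp (-c * v)).aestronglyMeasurable ?_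
    filter_upwards [ae_restrict_mem measurableSet_Ioi] with v hv
    rw [norm_mul, hnorm, norm_real, Real.norm_of_nonneg (le_of_lt hv)]
    simp
  refine ⟨hint, ?_⟩
  have hderiv : ∀ v : ℝ, HasDerivAt (fun v : ℝ => -((v : ℂ) / c + 1 / c ^ 2) * exp (-c * v))
      ((v : ℂ) * exp (-c * v)) v := fun v => by
    have h1 : HasDerivAt (fun v : ℝ => (v : ℂ)) 1 v := ofRealCLM.hasDerivAt
    have h2 := (((h1.div_const c).add_const (1 / c ^ 2)).neg).mul ((h1.const_mul (-c)).cexp)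
    refine h2.congr_deriv ?_
    simp only [Pi.neg_apply]
    field_simp
    ring
  have hlim : Tendsto (fun v : ℝ => -((v : ℂ) / c + 1 / c ^ 2) * exp (-c * v)) atTop (𝓝 0) := by
    have t1 : Tendsto (fun v : ℝ => v ^ (1 : ℝ) * Real.exp (-c.re * v)) atTop (𝓝 0) :=
      tendsto_rpow_mul_exp_neg_mul_atTop_nhds_zero 1 c.re hc
    have t0 : Tendsto (fun v : ℝ => v ^ (0 : ℝ) * Real.exp (-c.re * v)) atTop (𝓝 0) :=
      tendsto_rpow_mul_exp_neg_mul_atTop_nhds_zero 0 c.re hc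
    have e1 : Tendsto (fun v : ℝ => (v : ℂ) * exp (-c * v)) atTop (𝓝 0) := by
      refine squeeze_zero_norm' ?_ t1
      filter_upwards [eventually_ge_atTop 0] with v hv
      rw [norm_mul, hnorm, norm_real, Real.norm_of_nonneg hv, Real.rpow_one]
    have e0 : Tendsto (fun v : ℝ => exp (-c * v)) atTop (𝓝 0) := by
      refine squeeze_zero_norm' (Eventually.of_forall fun v => ?_) t0
      rw [hnorm]; simp
    have := (e1.mul_const (-1 / c)).add (e0.mul_const (-1 / c ^ 2))
    simp only [zero_mul, add_zero] at this
    refine this.congr fun v => ?_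
    ring
  rw [integral_Ioi_of_hasDerivAt_of_tendsto' (fun v _ => hderiv v) hint hlim]
  simp

theorem norm_sq_add_mul_I (a s : ℝ) : ‖(a + s * I : ℂ) ^ 2‖ = a ^ 2 + s ^ 2 := by
  rw [norm_pow, ← normSq_eq_norm_sq, normSq_add_mul_I]

theorem continuous_exp_div_sq {a : ℝ} (ha : a ≠ 0) (t : ℝ) :
    Continuous fun s : ℝ => exp (s * I * t) / (a + s * I) ^ 2 :=
  Continuous.div (by fun_prop) (by fun_prop) fun s => pow_ne_zero 2 (add_mul_I_ne_zero ha s)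

theorem norm_exp_div_sq_le {a : ℝ} (ha : 1 ≤ a) (s t : ℝ) :
    ‖exp (s * I * t) / (a + s * I) ^ 2‖ ≤ (1 + s ^ 2)⁻¹ := by
  rw [norm_div, norm_exp_mul_I_mul, norm_sq_add_mul_I, one_div]
  gcongr
  exact one_le_pow₀ ha

theorem integrable_exp_div_sq {a : ℝ} (ha : 1 ≤ a) (t : ℝ) :
    Integrable fun s : ℝ => exp (s * I * t) / (a + s * I) ^ 2 :=
  integrable_inv_one_add_sq.mono'
    (continuous_exp_div_sq (by linarith) t).aestronglyMeasurable
    (ae_of_all _ fun s => norm_exp_div_sq_le ha s t)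

/-- Fourier inversion for `v₊ e^{-av}`. The square matters: this function is continuous with
integrable transform, whereas `1/(a + is)` is not absolutely integrable. -/
theorem integral_exp_div_sq {a t : ℝ} (ha : 1 ≤ a) (ht : 0 < t) :
    ∫ s : ℝ, exp (s * I * t) / (a + s * I) ^ 2 = 2 * Real.pi * (t * exp (-a * t)) := by
  let φ : ℝ → ℂ := fun v => (max v 0 : ℝ) * exp (-a * v)
  have hφc : Continuous φ := by fun_prop
  have hφ : ∀ k : ℝ → ℂ, (fun v => k v * φ v) = (Ioi 0).indicator fun v => k v * (v * exp (-a * v)) := by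
    intro k
    ext v
    by_cases hv : v ∈ Ioi (0 : ℝ)
    · simp [φ, indicator_of_mem hv, max_eq_left (le_of_lt (mem_Ioi.1 hv))]
    · simp [φ, indicator_of_notMem hv, max_eq_right (not_lt.1 (mem_Ioi.not.1 hv))]
  have hφi : Integrable φ := by
    have := hφ 1
    simp only [Pi.one_apply, one_mul] at this
    rw [show φ = _ from this, integrable_indicator_iff measurableSet_Ioi]
    exact (integral_Ioi_mul_exp_neg (c := a) (by simp; linarith)).1
  have hF : ∀ w : ℝ, 𝓕 φ w = 1 / (a + (2 * Real.pi * w : ℝ) * I) ^ 2 := by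
    intro w
    rw [Real.fourier_real_eq_integral_exp_smul]
    simp_rw [smul_eq_mul]
    rw [hφ, integral_indicator measurableSet_Ioi,
      ← (integral_Ioi_mul_exp_neg (c := a + (2 * Real.pi * w : ℝ) * I) (by simp; linarith)).2]
    refine setIntegral_congr_fun measurableSet_Ioi fun v _ => ?_
    rw [mul_left_comm, ← Complex.exp_add]
    congr 2
    push_cast; ring_nf
  have hsub : ∀ k : ℝ → ℂ, ∫ w, k (2 * Real.pi * w) = (2 * Real.pi : ℂ)⁻¹ * ∫ s, k s := fun k => by
    rw [Measure.integral_comp_mul_left, abs_of_pos (by positivity), real_smul]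
    push_cast; rfl
  have hFi : Integrable (𝓕 φ) := by
    rw [show 𝓕 φ = _ from funext hF]
    have := (integrable_exp_div_sq ha 0).comp_mul_left' (R := 2 * Real.pi) (by positivity)
    simpa using this
  have inv := congrFun (hφc.fourierInv_fourier_eq hφi hFi) t
  rw [Real.fourierInv_eq'] at inv
  have h := hsub fun s => exp (s * I * t) / (a + s * I) ^ 2
  have h2 : ∫ w : ℝ, exp ((2 * Real.pi * w : ℝ) * I * t) / (a + (2 * Real.pi * w : ℝ) * I) ^ 2
      = t * exp (-a * t) := by
    rw [← show φ t = t * exp (-a * t) by simp [φ, max_eq_left ht.le], ← inv]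
    congr 1; ext w
    rw [hF, smul_eq_mul, mul_one_div]
    congr 2
    push_cast; simp; ring
  rw [h2] at h
  rw [h, mul_inv_cancel_left₀ (by simp)]

/-- Integration by parts in `s` reduces the conditionally convergent integral to an absolutely
convergent one, at the price of boundary terms of order `1/M`. -/
theorem integral_exp_div_eq {a t : ℝ} (ha : 1 ≤ a) (ht : 0 < t) (M : ℝ) :
    ∫ s in (-M)..M, exp (s * I * t) / (a + s * I) =
      exp (M * I * t) / (I * t * (a + M * I)) -
        exp ((-M : ℝ) * I * t) / (I * t * (a + (-M : ℝ) * I)) +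
      (t : ℂ)⁻¹ * ∫ s in (-M)..M, exp (s * I * t) / (a + s * I) ^ 2 := by
  have ht0 : (t : ℂ) ≠ 0 := by exact_mod_cast ht.ne'
  have hne := add_mul_I_ne_zero (a := a) (by linarith)
  have hc : Continuous fun s : ℝ => exp (s * I * t) / (a + s * I) :=
    Continuous.div (by fun_prop) (by fun_prop) hne
  have hc2 := continuous_exp_div_sq (a := a) (by linarith) t
  have hderiv : ∀ s : ℝ, HasDerivAt (fun s : ℝ => exp (s * I * t) / (I * t * (a + s * I)))
      (exp (s * I * t) / (a + s * I) - (t : ℂ)⁻¹ * (exp (s * I * t) / (a + s * I) ^ 2)) s := by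
    intro s
    have h1 : HasDerivAt (fun v : ℝ => (v : ℂ)) 1 s := ofRealCLM.hasDerivAt
    have h2 := (((h1.mul_const I).mul_const (t : ℂ)).cexp).div
      (((h1.mul_const I).const_add (a : ℂ)).const_mul (I * t))
      (mul_ne_zero (mul_ne_zero I_ne_zero ht0) (hne s))
    refine h2.congr_deriv ?_
    have := hne s
    have := I_ne_zero
    field_simp
  have := intervalIntegral.integral_eq_sub_of_hasDerivAt (fun s _ => hderiv s)
    ((hc.sub (hc2.const_mul _)).intervalIntegrable (-M) M)
  rw [intervalIntegral.integral_sub (hc.intervalIntegrable _ _)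
    ((hc2.const_mul _).intervalIntegrable _ _), intervalIntegral.integral_const_mul] at this
  rw [← this]; ring

theorem norm_boundary_le (a : ℝ) {t : ℝ} (ht : 0 < t) (M : ℝ) :
    ‖exp (M * I * t) / (I * t * (a + M * I))‖ ≤ t⁻¹ * ‖(a + M * I : ℂ)‖⁻¹ := by
  rw [norm_div, norm_exp_mul_I_mul]
  simp [abs_of_pos ht, mul_comm]

theorem tendsto_integral_exp_div {a t : ℝ} (ha : 1 ≤ a) (ht : 0 < t) :
    Tendsto (fun M : ℝ => ∫ s in (-M)..M, exp (s * I * t) / (a + s * I)) atTop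
      (𝓝 (2 * Real.pi * exp (-a * t))) := by
  simp_rw [integral_exp_div_eq ha ht]
  have hM : ∀ {l : Filter ℝ}, Tendsto (fun M : ℝ => |M|) l atTop →
      Tendsto (fun M : ℝ => exp (M * I * t) / (I * t * (a + M * I))) l (𝓝 0) := by
    intro l hl
    refine squeeze_zero_norm (norm_boundary_le a ht) ?_
    rw [← mul_zero t⁻¹]
    refine (tendsto_inv_atTop_zero.comp (tendsto_atTop_mono (fun M => ?_) hl)).const_mul _
    simpa using abs_im_le_norm (a + M * I : ℂ)
  have h1 := hM tendsto_abs_atTop_atTop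
  have h2 := (hM tendsto_abs_atBot_atTop).comp tendsto_neg_atTop_atBot
  have h3 := (intervalIntegral_tendsto_integral (integrable_exp_div_sq ha t)
    tendsto_neg_atTop_atBot tendsto_id).const_mul (t : ℂ)⁻¹
  have := (h1.sub h2).add h3
  refine this.trans_eq ?_
  have ht0 : (t : ℂ) ≠ 0 := by exact_mod_cast ht.ne'
  rw [integral_exp_div_sq ha ht]
  congr 1; field_simp; simp

/-- Each boundary term is at most `1/t`, and `π = ∫ ds/(1 + s²)` bounds the remaining integral.
Uniformity in `a` and `M` supplies the dominating series later. -/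
theorem norm_integral_exp_div_le {a t : ℝ} (ha : 1 ≤ a) (ht : 0 < t) {M : ℝ} (hM : 0 ≤ M) :
    ‖∫ s in (-M)..M, exp (s * I * t) / (a + s * I)‖ ≤ t⁻¹ * (2 + Real.pi) := by
  rw [integral_exp_div_eq ha ht]
  have hb : ∀ M : ℝ, ‖exp (M * I * t) / (I * t * (a + M * I))‖ ≤ t⁻¹ := fun M => by
    refine (norm_boundary_le a ht M).trans ?_
    have : ‖(a + M * I : ℂ)‖⁻¹ ≤ 1 :=
      inv_le_one_of_one_le₀ (ha.trans (le_norm_add_mul_I (by linarith) M))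
    exact mul_le_of_le_one_right (by positivity) this
  have hi : ‖∫ s in (-M)..M, exp (s * I * t) / (a + s * I) ^ 2‖ ≤ Real.pi := by
    rw [intervalIntegral.integral_of_le (by linarith), ← integral_univ_inv_one_add_sq]
    refine (norm_integral_le_of_norm_le integrable_inv_one_add_sq.integrableOn
      (ae_of_all _ fun s => norm_exp_div_sq_le ha s t)).trans ?_
    exact setIntegral_le_integral integrable_inv_one_add_sq (ae_of_all _ fun s => by
      simp only [Pi.zero_apply]; positivity)
  refine (norm_add_le _ _).trans ?_
  have := (norm_sub_le _ _).trans (add_le_add (hb M) (hb (-M)))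
  have h3 : ‖(t : ℂ)⁻¹ * ∫ s in (-M)..M, exp (s * I * t) / (a + s * I) ^ 2‖ ≤ t⁻¹ * Real.pi := by
    rw [norm_mul, norm_inv, norm_real, Real.norm_of_nonneg ht.le]
    gcongr
  linarith

end

/-! ### Sine series of the data and of the solution -/

section

open Complex ProbabilityTheory

/-- Two integrations by parts, with boundary terms cancelled by periodicity, give Fourier
coefficients of order `1/n²`. Indexing by `ℤ` keeps the complex Fourier series in use. -/
theorem exists_hasSum_sin {F F₁ F₂ : ℝ → ℝ} (hF : ∀ x, HasDerivAt F (F₁ x) x)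
    (hF₁ : ∀ x, HasDerivAt F₁ (F₂ x) x) (hF₂ : Continuous F₂) (hodd : ∀ x, F (-x) = -F x)
    (hper : Function.Periodic F 2) (hper₁ : Function.Periodic F₁ 2) {C : ℝ}
    (hC : ∀ x, |F₂ x| ≤ C) :
    ∃ b : ℤ → ℂ, Summable (fun n => ‖b n‖) ∧ b 0 = 0 ∧
      ∀ x : ℝ, HasSum (fun n : ℤ => b n * Real.sin (Real.pi * n * x)) (F x) := by
  have : Fact ((0 : ℝ) < 2) := ⟨two_pos⟩
  have hFc : Continuous F := continuous_iff_continuousAt.2 fun x => (hF x).continuousAt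
  have hF₁c : Continuous F₁ := continuous_iff_continuousAt.2 fun x => (hF₁ x).continuousAt
  let G : C(AddCircle (2 : ℝ), ℂ) := ⟨fun x => (hper.lift x : ℂ), by
    refine continuous_ofReal.comp ?_
    exact continuous_coinduced_dom.2 hFc⟩
  have hG : ∀ x : ℝ, G (x : AddCircle (2 : ℝ)) = F x := fun x => rfl
  have hcoeff : ∀ n, fourierCoeff G n = fourierCoeffOn two_pos (fun x => (F x : ℂ)) n := fun n => by
    rw [fourierCoeff_eq_intervalIntegral _ _ 0, fourierCoeffOn_eq_integral]
    simp [hG]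
  have hbound : ∀ n : ℤ, n ≠ 0 → ‖fourierCoeff G n‖ ≤ C * (1 / (n : ℝ) ^ 2) := by
    intro n hn
    have h2 : ‖fourierCoeffOn two_pos (fun x => (F₂ x : ℂ)) n‖ ≤ C := by
      rw [fourierCoeffOn_eq_integral, norm_smul]
      have := intervalIntegral.norm_integral_le_of_norm_le_const (a := (0 : ℝ)) (b := 2) (C := C)
        (f := fun x : ℝ => fourier (-n) (x : AddCircle ((2 : ℝ) - 0)) • (F₂ x : ℂ)) fun x _ => by
          rw [norm_smul, fourier_apply, Circle.norm_coe, one_mul, norm_real]; exact hC x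
      norm_num at this ⊢
      linarith
    have hn' : (n : ℝ) ≠ 0 := by exact_mod_cast hn
    have hp2 : F 2 = F 0 := by simpa using hper 0
    have hp2' : F₁ 2 = F₁ 0 := by simpa using hper₁ 0
    rw [hcoeff, fourierCoeffOn_of_hasDerivAt two_pos hn (fun x _ => (hF x).ofReal_comp)
        ((continuous_ofReal.comp hF₁c).intervalIntegrable _ _),
      fourierCoeffOn_of_hasDerivAt two_pos hn (fun x _ => (hF₁ x).ofReal_comp)
        ((continuous_ofReal.comp hF₂).intervalIntegrable _ _), hp2, hp2']
    simp only [sub_self, mul_zero, zero_sub, norm_mul, norm_neg, norm_div]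
    have e : ‖((2 : ℝ) : ℂ) - ((0 : ℝ) : ℂ)‖ = 2 := by simp
    simp only [e, norm_one, norm_ofNat, norm_real, norm_I, norm_intCast,
      Real.norm_of_nonneg Real.pi_pos.le, mul_one]
    have hpi : 1 ≤ Real.pi := by linarith [Real.pi_gt_three]
    have hn0 : 0 < |(n : ℝ)| := abs_pos.2 hn'
    calc _ = ‖fourierCoeffOn two_pos (fun x => (F₂ x : ℂ)) n‖ * (1 / (n : ℝ) ^ 2) *
          (1 / Real.pi ^ 2) := by rw [← sq_abs (n : ℝ)]; field_simp
      _ ≤ C * (1 / (n : ℝ) ^ 2) * 1 := by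
        have := (abs_nonneg _).trans (hC 0)
        gcongr
        rw [div_le_one (by positivity)]
        exact one_le_pow₀ hpi
      _ = _ := mul_one _
  have hsum : Summable (fourierCoeff G) :=
    Summable.of_norm_bounded_eventually
      (((Real.summable_one_div_int_pow (p := 2)).2 one_lt_two).mul_left C)
      ((eventually_cofinite_ne (0 : ℤ)).mono fun n hn => hbound n hn)
  have hFs := fun x : ℝ => has_pointwise_sum_fourier_series_of_summable hsum (x : AddCircle (2 : ℝ))
  -- The mode `n = 0` contributes nothing since `sin 0 = 0`; forcing its coefficient to be zero
  -- later removes the singular factor `1/(is)`.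
  refine ⟨fun n => if n = 0 then 0 else I * fourierCoeff G n,
    Summable.of_nonneg_of_le (fun _ => norm_nonneg _) (fun n => ?_) hsum.norm, by simp,
    fun x => ?_⟩
  · dsimp only
    split_ifs <;> simp
  -- By oddness `F x = (F x - F (-x)) / 2`, which turns each exponential into `I` times a sine.
  have h := ((hFs x).sub (hFs (-x))).mul_right (1 / 2)
  rw [hG, hG, hodd] at h
  convert! h using 1
  · ext n
    simp only [fourier_coe_apply, smul_eq_mul]
    rcases eq_or_ne n 0 with rfl | hn
    · simp
    · rw [if_neg hn, ofReal_sin, Complex.sin]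
      have e1 : (2 * Real.pi * I * n * x / (2 : ℝ) : ℂ) = (Real.pi * n * x : ℝ) * I := by
        push_cast; ring
      have e2 : (2 * Real.pi * I * n * (-x : ℝ) / (2 : ℝ) : ℂ) = -(Real.pi * n * x : ℝ) * I := by
        push_cast; ring
      rw [e1, e2]
      linear_combination (-1 / 2 * fourierCoeff G n * (cexp ((Real.pi * n * x : ℝ) * I) -
        cexp (-(Real.pi * n * x : ℝ) * I))) * I_sq
  · push_cast; ring

/-- Split the sine into exponentials and use the Gaussian characteristic function `e^{-q²/2}` at `q
= ±kc`. -/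
theorem integral_sin_gaussianReal (k c x : ℝ) :
    ∫ z, (Real.sin (k * (x + c * z)) : ℂ) ∂gaussianReal 0 1 =
      Real.sin (k * x) * exp (-(k * c) ^ 2 / 2) := by
  have h : ∀ q : ℝ, ∫ z : ℝ, exp (q * z * I) ∂gaussianReal 0 1 = exp (-q ^ 2 / 2) := fun q => by
    rw [← charFun_apply_real, charFun_gaussianReal]
    congr 1; simp; ring
  have hi : ∀ q : ℝ, Integrable (fun z : ℝ => exp (q * z * I)) (gaussianReal 0 1) := fun q =>
    Integrable.of_bound (by fun_prop : Continuous fun z : ℝ => exp (q * z * I)).aestronglyMeasurable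
      1 (ae_of_all _ fun z => by
        rw [← ofReal_mul, norm_exp_ofReal_mul_I])
  have e : ∀ z : ℝ, (Real.sin (k * (x + c * z)) : ℂ) =
      exp (-(k * x) * I) * (I / 2) * exp ((-(k * c) : ℝ) * z * I) -
        exp (k * x * I) * (I / 2) * exp ((k * c : ℝ) * z * I) := fun z => by
    have p₁ : exp (-(k * x) * I) * exp ((-(k * c) : ℝ) * z * I) =
        exp (-(k * (x + c * z) : ℝ) * I) := by
      rw [← Complex.exp_add]; push_cast; ring_nf
    have p₂ : exp (k * x * I) * exp ((k * c : ℝ) * z * I) = exp ((k * (x + c * z) : ℝ) * I) := by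
      rw [← Complex.exp_add]; push_cast; ring_nf
    rw [ofReal_sin, Complex.sin]
    linear_combination -(I / 2) * p₁ + (I / 2) * p₂
  simp_rw [e]
  rw [integral_sub ((hi _).const_mul _) ((hi _).const_mul _), integral_const_mul,
    integral_const_mul, h, h, ofReal_sin, Complex.sin]
  push_cast
  ring_nf

theorem hasSum_heat {F : ℝ → ℝ} {b : ℤ → ℂ} (hb : Summable fun n => ‖b n‖)
    (hF : ∀ x : ℝ, HasSum (fun n : ℤ => b n * Real.sin (Real.pi * n * x)) (F x)) (x : ℝ) {t : ℝ}
    (ht : 0 ≤ t) :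
    HasSum (fun n : ℤ => b n * Real.sin (Real.pi * n * x) * exp (-((Real.pi * n) ^ 2 : ℝ) * t))
      (heat F x t) := by
  have hle : ∀ (n : ℤ) (y : ℝ), ‖b n * Real.sin (Real.pi * n * y)‖ ≤ ‖b n‖ := fun n y => by
    rw [norm_mul, norm_real]
    exact mul_le_of_le_one_right (norm_nonneg _) (Real.abs_sin_le_one _)
  have hc : ∀ n : ℤ, Continuous fun z : ℝ =>
      b n * (Real.sin (Real.pi * n * (x + √(2 * t) * z)) : ℂ) := fun n => by fun_prop
  have h := hasSum_integral_of_summable_integral_norm (μ := gaussianReal 0 1)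
    (F := fun (n : ℤ) z => b n * Real.sin (Real.pi * n * (x + √(2 * t) * z)))
    (fun n => Integrable.of_bound (hc n).aestronglyMeasurable ‖b n‖ (ae_of_all _ fun z => hle n _))
    (Summable.of_nonneg_of_le (fun n => integral_nonneg fun z => norm_nonneg _) (fun n => by
      refine (integral_mono_of_nonneg (ae_of_all _ fun z => norm_nonneg _)
        (integrable_const ‖b n‖) (ae_of_all _ fun z => hle n _)).trans ?_
      simp) hb)
  simp_rw [fun y => (hF y).tsum_eq] at h
  rw [integral_complex_ofReal] at h
  convert! h using 1
  ext n
  symm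
  rw [integral_const_mul, integral_sin_gaussianReal, ← mul_assoc]
  congr 2
  have : (√(2 * t)) ^ 2 = 2 * t := Real.sq_sqrt (by linarith)
  have h2 : (√(2 * t) : ℂ) ^ 2 = 2 * t := by exact_mod_cast this
  push_cast
  linear_combination (-(Real.pi * n) ^ 2 / 2 : ℂ) * h2

end

/-! ### The Green's function on sine modes -/

section

open Complex

theorem continuous_green (m : ℂ) (x : ℝ) : Continuous (green m x) := by
  unfold green
  rcases eq_or_ne m 0 with hm | hm
  · simp only [hm, if_true]
    refine Continuous.if_le (by fun_prop) (by fun_prop) continuous_id continuous_const fun y hy => ?_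
    rw [show y = x from hy]; ring
  · simp only [hm, if_false]
    refine continuous_const.mul <|
      Continuous.if_le (by fun_prop) (by fun_prop) continuous_id continuous_const fun y hy => ?_
    rw [show y = x from hy]; ring

theorem integral_sinh_mul_sin {m : ℂ} {k : ℝ} (h : m ^ 2 + k ^ 2 ≠ 0) (c a b : ℝ) :
    ∫ y in a..b, sinh (m * (y - c)) * (Real.sin (k * y) : ℂ) =
      (m * cosh (m * (b - c)) * Real.sin (k * b) - k * sinh (m * (b - c)) * Real.cos (k * b)) /
          (m ^ 2 + k ^ 2) -
        (m * cosh (m * (a - c)) * Real.sin (k * a) - k * sinh (m * (a - c)) * Real.cos (k * a)) /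
          (m ^ 2 + k ^ 2) := by
  refine intervalIntegral.integral_eq_sub_of_hasDerivAt (f := fun y : ℝ =>
    (m * cosh (m * (y - c)) * Real.sin (k * y) - k * sinh (m * (y - c)) * Real.cos (k * y)) /
      (m ^ 2 + k ^ 2)) (fun y _ => ?_)
    ((by fun_prop : Continuous fun y : ℝ =>
      sinh (m * (y - c)) * (Real.sin (k * y) : ℂ)).intervalIntegrable _ _)
  have h1 : HasDerivAt (fun v : ℝ => m * ((v : ℂ) - c)) m y := by
    simpa using ((ofRealCLM.hasDerivAt (x := y)).sub_const (c : ℂ)).const_mul m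
  have hk : HasDerivAt (fun v : ℝ => k * v) k y := by simpa using (hasDerivAt_id y).const_mul k
  have hs := hk.sin.ofReal_comp
  have hc := hk.cos.ofReal_comp
  have hch := ((Complex.hasDerivAt_cosh _).comp y h1).const_mul m
  have hsh := ((Complex.hasDerivAt_sinh _).comp y h1).const_mul (k : ℂ)
  refine (((hch.mul hs).sub (hsh.mul hc)).div_const (m ^ 2 + k ^ 2)).congr_deriv ?_
  rw [div_eq_iff h]
  simp only [Function.comp_apply]
  push_cast
  ring

theorem integral_sub_mul_sin {k : ℝ} (h : k ≠ 0) (c a b : ℝ) :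
    ∫ y in a..b, (y - c) * Real.sin (k * y) =
      (Real.sin (k * b) / k ^ 2 - (b - c) * Real.cos (k * b) / k) -
        (Real.sin (k * a) / k ^ 2 - (a - c) * Real.cos (k * a) / k) := by
  refine intervalIntegral.integral_eq_sub_of_hasDerivAt (f := fun y : ℝ =>
    Real.sin (k * y) / k ^ 2 - (y - c) * Real.cos (k * y) / k) (fun y _ => ?_)
    ((by fun_prop : Continuous fun y : ℝ => (y - c) * Real.sin (k * y)).intervalIntegrable _ _)
  have hk : HasDerivAt (fun v : ℝ => k * v) k y := by simpa using (hasDerivAt_id y).const_mul k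
  refine ((hk.sin.div_const (k ^ 2)).sub
    ((((hasDerivAt_id y).sub_const c).mul hk.cos).div_const k)).congr_deriv ?_
  simp only [id]
  field_simp
  ring

/-- `sin(ky)` is a Dirichlet eigenfunction of `-v'' + m²v` with eigenvalue `m² + k²`, and the
Green's function inverts this operator. The check is by explicit antiderivatives on either side of
`y = x`. -/
theorem integral_green_mul_sin {m : ℂ} {k : ℝ} (hm : m = 0 ∨ sinh m ≠ 0) (hk : Real.sin k = 0)
    (h : m ^ 2 + k ^ 2 ≠ 0) {x : ℝ} (hx : x ∈ Icc (0 : ℝ) 1) :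
    ∫ y in (0 : ℝ)..1, green m x y * Real.sin (k * y) = Real.sin (k * x) / (m ^ 2 + k ^ 2) := by
  have hc : Continuous fun y => green m x y * (Real.sin (k * y) : ℂ) :=
    (continuous_green m x).mul (by fun_prop)
  rw [← intervalIntegral.integral_add_adjacent_intervals (hc.intervalIntegrable 0 x)
    (hc.intervalIntegrable x 1)]
  have left : ∀ y ∈ Ioo 0 x, y ≤ x := fun y hy => hy.2.le
  have right : ∀ y ∈ Ioo x 1, ¬ y ≤ x := fun y hy => not_le.2 hy.1
  rcases eq_or_ne m 0 with rfl | hm0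
  · have hk0 : k ≠ 0 := by rintro rfl; simp at h
    have hk0' : (k : ℂ) ≠ 0 := by exact_mod_cast hk0
    rw [intervalIntegral.integral_congr_Ioo_of_le
        (g := fun y : ℝ => (((1 - x) * ((y - 0) * Real.sin (k * y)) : ℝ) : ℂ)) hx.1
        fun y hy => by simp [green, left y hy, mul_assoc],
      intervalIntegral.integral_congr_Ioo_of_le
        (g := fun y : ℝ => ((-x * ((y - 1) * Real.sin (k * y)) : ℝ) : ℂ)) hx.2
        fun y hy => by simp only [green, if_true, if_neg (right y hy)]; push_cast; ring,
      intervalIntegral.integral_ofReal, intervalIntegral.integral_ofReal,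
      intervalIntegral.integral_const_mul, intervalIntegral.integral_const_mul,
      integral_sub_mul_sin hk0, integral_sub_mul_sin hk0]
    simp only [mul_zero, mul_one, hk, Real.sin_zero]
    push_cast
    field_simp
    ring
  · have hs : sinh m ≠ 0 := hm.resolve_left hm0
    rw [intervalIntegral.integral_congr_Ioo_of_le
        (g := fun y : ℝ => -1 / (m * sinh m) * sinh (m * (x - 1)) *
          (sinh (m * (y - (0 : ℝ))) * Real.sin (k * y))) hx.1
        fun y hy => by simp only [green, if_neg hm0, if_pos (left y hy)]; push_cast; ring_nf,
      intervalIntegral.integral_congr_Ioo_of_le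
        (g := fun y : ℝ => -1 / (m * sinh m) * sinh (m * x) *
          (sinh (m * (y - (1 : ℝ))) * Real.sin (k * y))) hx.2
        fun y hy => by simp only [green, if_neg hm0, if_neg (right y hy)]; push_cast; ring_nf,
      intervalIntegral.integral_const_mul, intervalIntegral.integral_const_mul,
      integral_sinh_mul_sin h, integral_sinh_mul_sin h]
    -- The contributions at `y = x` combine into `sinh(m(x - 1) - mx) = -sinh m`, cancelling the
    -- normalisation.
    have hsub := Complex.sinh_sub (m * (x - 1)) (m * x)
    rw [show m * ((x : ℂ) - 1) - m * x = -m by ring, Complex.sinh_neg] at hsub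
    simp only [mul_zero, mul_one, hk, Real.sin_zero, ofReal_zero, ofReal_one, sub_zero, sub_self,
      Complex.sinh_zero, zero_mul, zero_div, zero_sub]
    field_simp
    linear_combination (m * Real.sin (k * x) : ℂ) * hsub

/-- Zeros of `sinh` lie at `iπn`, where `m²` is real; a real number equal to `is` is zero. -/
theorem eq_zero_or_sinh_ne_zero_of_sq_eq {m : ℂ} {s : ℝ} (h : m ^ 2 = I * s) :
    m = 0 ∨ sinh m ≠ 0 := by
  by_contra! hcon
  obtain ⟨hm, hs⟩ := hcon
  have h1 : sin (m * I) = 0 := by rw [Complex.sin_mul_I, hs, zero_mul]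
  obtain ⟨n, hn⟩ := Complex.sin_eq_zero_iff.1 h1
  have h2 : I * s = -((n * Real.pi : ℝ) ^ 2 : ℝ) := by
    rw [← h]
    push_cast
    rw [← hn, mul_pow, I_sq]; ring
  have h3 : s = 0 := by simpa [← ofReal_pow] using congrArg Complex.im h2
  rw [h3] at h
  simp at h
  exact hm h

/-- Termwise integration of the sine series. Only `m²` survives in the result, so the choice of
square root is immaterial. -/
theorem hasSum_integral_green {f : ℝ → ℝ} {b : ℤ → ℂ} (hb : Summable fun n => ‖b n‖)
    (hb0 : b 0 = 0)
    (hf : ∀ y ∈ Icc (0 : ℝ) 1, HasSum (fun n : ℤ => b n * Real.sin (Real.pi * n * y)) (f y))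
    {m : ℂ} {s : ℝ} (hm : m ^ 2 = I * s) {x : ℝ} (hx : x ∈ Icc (0 : ℝ) 1) (t : ℝ) :
    HasSum (fun n : ℤ => b n * Real.sin (Real.pi * n * x) *
        (exp (s * I * t) / (((Real.pi * n) ^ 2 : ℝ) + s * I)))
      (∫ y in (0 : ℝ)..1, exp (s * I * t) * green m x y * f y) := by
  have hg := continuous_green m x
  obtain ⟨C, hC⟩ := isCompact_Icc.exists_bound_of_continuousOn (s := Icc (0 : ℝ) 1)
    (f := fun y => exp (s * I * t) * green m x y) (by fun_prop)
  have hc : ∀ n : ℤ, Continuous fun y : ℝ =>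
      exp (s * I * t) * green m x y * (b n * (Real.sin (Real.pi * n * y) : ℂ)) := fun n => by
    fun_prop
  have hmem : ∀ y ∈ uIoc (0 : ℝ) 1, y ∈ Icc (0 : ℝ) 1 := fun y hy =>
    Ioc_subset_Icc_self (by rwa [uIoc_of_le zero_le_one] at hy)
  have h := intervalIntegral.hasSum_integral_of_dominated_convergence (μ := volume)
    (a := 0) (b := 1) (f := fun y : ℝ => exp (s * I * t) * green m x y * f y)
    (F := fun (n : ℤ) y =>
      exp (s * I * t) * green m x y * (b n * (Real.sin (Real.pi * n * y) : ℂ)))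
    (fun n _ => C * ‖b n‖) (fun n => (hc n).aestronglyMeasurable)
    (fun n => ae_of_all _ fun y hy => by
      rw [norm_mul, norm_mul (b n), norm_real]
      have h0 := (norm_nonneg _).trans (hC y (hmem y hy))
      exact mul_le_mul (hC y (hmem y hy))
        (mul_le_of_le_one_right (norm_nonneg _) (Real.abs_sin_le_one _)) (by positivity) h0)
    (ae_of_all _ fun y _ => hb.mul_left C) intervalIntegrable_const
    (ae_of_all _ fun y hy => (hf y (hmem y hy)).mul_left _)
  convert! h using 1
  ext n
  symm
  rcases eq_or_ne n 0 with rfl | hn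
  · simp [hb0]
  have hk : Real.sin (Real.pi * n) = 0 := by rw [mul_comm]; exact Real.sin_int_mul_pi n
  have hne : m ^ 2 + (Real.pi * n : ℝ) ^ 2 ≠ 0 := fun h0 => by
    have := congrArg Complex.re h0
    rw [hm, ← ofReal_pow, add_re, ofReal_re] at this
    simp [Real.pi_ne_zero, hn] at this
  have hI := integral_green_mul_sin (eq_zero_or_sinh_ne_zero_of_sq_eq hm) hk hne hx
  rw [hm] at hI
  calc _ = ∫ y in (0 : ℝ)..1, exp (s * I * t) * b n *
        (green m x y * Real.sin (Real.pi * n * y)) := by congr 1; ext y; ring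
    _ = _ := by
      rw [intervalIntegral.integral_const_mul, hI]
      push_cast
      ring

end

/-! ### Principal value of the series -/

theorem one_le_pi_mul_int_sq {n : ℤ} (hn : n ≠ 0) : 1 ≤ (Real.pi * n) ^ 2 := by
  have h1 : (1 : ℝ) ≤ |(n : ℝ)| := by exact_mod_cast Int.one_le_abs hn
  rw [← sq_abs, abs_mul, abs_of_pos Real.pi_pos]
  exact one_le_pow₀ (one_le_mul_of_one_le_of_one_le (by linarith [Real.pi_gt_three]) h1)

open Complex in
-- Dominated convergence is used twice: on `[-M, M]` with `‖bₙ‖`, because `|(πn)² + is| ≥ 1`, and as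
-- `M → ∞` for the series of truncated integrals, with `‖bₙ‖ (2 + π)/t`.
theorem hasPVIntegral_of_hasSum {φ : ℝ → ℂ} {b a : ℤ → ℂ} {u : ℂ} {t : ℝ} (ht : 0 < t)
    (hb : Summable fun n => ‖b n‖) (hb0 : b 0 = 0) (ha : ∀ n, ‖a n‖ ≤ 1)
    (hφ : ∀ s : ℝ, HasSum
      (fun n : ℤ => b n * a n * (exp (s * I * t) / (((Real.pi * n) ^ 2 : ℝ) + s * I))) (φ s))
    (hu : HasSum (fun n : ℤ => b n * a n * exp (-((Real.pi * n) ^ 2 : ℝ) * t)) u) :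
    HasPVIntegral φ (2 * Real.pi * u) := by
  have hba : ∀ n, ‖b n * a n‖ ≤ ‖b n‖ := fun n => by
    rw [norm_mul]; exact mul_le_of_le_one_right (norm_nonneg _) (ha n)
  have hcont : ∀ n : ℤ, Continuous fun s : ℝ =>
      b n * a n * (exp (s * I * t) / (((Real.pi * n) ^ 2 : ℝ) + s * I)) := fun n => by
    rcases eq_or_ne n 0 with rfl | hn
    · simpa [hb0] using continuous_const
    · have h1 := one_le_pi_mul_int_sq hn
      exact continuous_const.mul (Continuous.div (by fun_prop) (by fun_prop)
        fun s => add_mul_I_ne_zero (by linarith) s)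
  have hle : ∀ (n : ℤ) (s : ℝ),
      ‖b n * a n * (exp (s * I * t) / (((Real.pi * n) ^ 2 : ℝ) + s * I))‖ ≤ ‖b n‖ := fun n s => by
    rcases eq_or_ne n 0 with rfl | hn
    · simp [hb0]
    · have h1 := one_le_pi_mul_int_sq hn
      rw [norm_mul, norm_div, norm_exp_mul_I_mul]
      refine (mul_le_of_le_one_right (norm_nonneg _) ?_).trans (hba n)
      exact div_le_one_of_le₀ (h1.trans (le_norm_add_mul_I (by linarith) s)) (norm_nonneg _)
  have hφc : Continuous φ := by
    rw [show φ = _ from funext fun s => (hφ s).tsum_eq.symm]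
    exact continuous_tsum hcont hb hle
  have hint : ∀ M : ℝ, ∫ s in (-M)..M, φ s = ∑' n : ℤ, b n * a n *
      ∫ s in (-M)..M, exp (s * I * t) / (((Real.pi * n) ^ 2 : ℝ) + s * I) := fun M => by
    have h := intervalIntegral.hasSum_integral_of_dominated_convergence (μ := volume)
      (a := -M) (b := M) (f := φ)
      (F := fun (n : ℤ) (s : ℝ) =>
        b n * a n * (exp (s * I * t) / (((Real.pi * n) ^ 2 : ℝ) + s * I)))
      (fun n _ => ‖b n‖) (fun n => (hcont n).aestronglyMeasurable)
      (fun n => ae_of_all _ fun s _ => hle n s) (ae_of_all _ fun s _ => hb)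
      intervalIntegrable_const (ae_of_all _ fun s _ => hφ s)
    rw [← h.tsum_eq]
    simp_rw [intervalIntegral.integral_const_mul]
  refine ⟨fun M => hφc.intervalIntegrable _ _, ?_⟩
  simp_rw [hint]
  rw [← hu.tsum_eq, ← tsum_mul_left]
  refine tendsto_tsum_of_dominated_convergence
    (bound := fun n => ‖b n‖ * (t⁻¹ * (2 + Real.pi))) (hb.mul_right _) (fun n => ?_) ?_
  · rcases eq_or_ne n 0 with rfl | hn
    · simp [hb0]
    · have := (tendsto_integral_exp_div (one_le_pi_mul_int_sq hn) ht).const_mul (b n * a n)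
      rwa [mul_left_comm] at this
  · filter_upwards [eventually_ge_atTop 0] with M hM n
    rcases eq_or_ne n 0 with rfl | hn
    · simp [hb0]
    · rw [norm_mul]
      exact mul_le_mul (hba n) (norm_integral_exp_div_le (one_le_pi_mul_int_sq hn) ht hM)
        (norm_nonneg _) (norm_nonneg _)

end HeatDirichlet


/-! ### The representation theorem -/

theorem theorem2p3 (f : ℝ → ℝ) (hf : ContDiffOn ℝ 2 f (Set.Icc 0 1))
    (hf0 : f 0 = 0) (hf1 : f 1 = 0)
    (hf0'' : iteratedDerivWithin 2 f (Set.Icc 0 1) 0 = 0)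
    (hf1'' : iteratedDerivWithin 2 f (Set.Icc 0 1) 1 = 0) :
    ∃ u : ℝ → ℝ → ℝ,
      HeatDirichlet.IsBoundedSolution (fun _ _ => 0) f u ∧
      (∀ v : ℝ → ℝ → ℝ, HeatDirichlet.IsBoundedSolution (fun _ _ => 0) f v →
        ∀ x ∈ Set.Icc (0 : ℝ) 1, ∀ t ∈ Set.Ici (0 : ℝ), v x t = u x t) ∧
      -- the choice of the square root `r s` of `i s` is arbitrary for every `s`
      ∀ r : ℝ → ℂ, (∀ s : ℝ, r s ^ 2 = Complex.I * s) →
        ∀ x ∈ Set.Icc (0 : ℝ) 1, ∀ t ∈ Set.Ioi (0 : ℝ),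
          (∀ s : ℝ, IntervalIntegrable
            (fun y : ℝ => Complex.exp (s * Complex.I * t) * HeatDirichlet.green (r s) x y * f y)
            MeasureTheory.volume 0 1) ∧
          ∃ L : ℂ,
            HeatDirichlet.HasPVIntegral
              (fun s : ℝ => ∫ y in (0 : ℝ)..1,
                Complex.exp (s * Complex.I * t) * HeatDirichlet.green (r s) x y * f y) L ∧
            (u x t : ℂ) = 1 / (2 * Real.pi) * L := by
  obtain ⟨F, F₁, F₂, hF, hF₁, hF₂, hodd, hper, hper₁, hper₂, hFf⟩ :=
    HeatDirichlet.exists_odd_periodic_C2_extension hf hf0 hf1 hf0'' hf1''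
  have hFc : Continuous F := continuous_iff_continuousAt.2 fun x => (hF x).continuousAt
  have hF₁c : Continuous F₁ := continuous_iff_continuousAt.2 fun x => (hF₁ x).continuousAt
  obtain ⟨C, hC⟩ := hper.exists_abs_le two_ne_zero hFc
  obtain ⟨C₁, hC₁⟩ := hper₁.exists_abs_le two_ne_zero hF₁c
  obtain ⟨C₂, hC₂⟩ := hper₂.exists_abs_le two_ne_zero hF₂
  obtain ⟨b, hb, hb0, hFb⟩ :=
    HeatDirichlet.exists_hasSum_sin hF hF₁ hF₂ hodd hper hper₁ hC₂
  have hsol := HeatDirichlet.isBoundedSolution_heat hF hF₁ hF₂ hodd hper hC hC₁ hC₂ hFf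
  refine ⟨HeatDirichlet.heat F, hsol, fun v hv x hx t ht => hv.unique hsol hx ht,
    fun r hr x hx t ht => ⟨fun s => ?_, _, HeatDirichlet.hasPVIntegral_of_hasSum ht hb hb0
      (a := fun n => Real.sin (Real.pi * n * x))
      (fun n => ?_) (fun s => HeatDirichlet.hasSum_integral_green hb hb0 (fun y hy => ?_) (hr s) hx t)
      (HeatDirichlet.hasSum_heat hb hFb x (le_of_lt ht)), ?_⟩⟩
  · refine ContinuousOn.intervalIntegrable ?_
    rw [Set.uIcc_of_le zero_le_one]
    exact (continuous_const.mul (HeatDirichlet.continuous_green (r s) x)).continuousOn.mul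
      (Complex.continuous_ofReal.comp_continuousOn hf.continuousOn)
  · rw [Complex.norm_real]
    exact Real.abs_sin_le_one _
  · rw [← hFf hy]
    exact hFb y
  · have : (Real.pi : ℂ) ≠ 0 := by exact_mod_cast Real.pi_ne_zero
    field_simp
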